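/- Let $K$ be a field and let $q\in K$ be a non-zero element that is not a root of unity. Let $A$ be the Liu–Schulz algebra, i.e. the associative unital $K$-algebra generated by $x_0,x_1,x_2$ subject to the relations $x_i^2=0$ and $x_{i+1}x_i+q\,x_ix_{i+1}=0$ for $i=0,1,2$ (indices modulo $3$). For a non-zero left module $M$ over a ring $R$, a finite quasi-projective resolution of $M$ is a bounded complex $P_\bullet$ of projective left $R$-modules (with differentials $P_i\to P_{i-1}$) such that for every $j$ there is an integer $n_j\ge 0$ with $H_j(P_\bullet)\cong M^{n_j}$, the $n_j$ not all being zero. The quasi-projective dimension $\mathrm{qpd}_R(M)\in\mathbb N\cup\{\infty\}$ is the infimum of $\sup\{i: P_i\neq 0\}-\sup\{i: H_i(P_\bullet)\ne 0\}$ over all such $P_\bullet$ ($\infty$ if there is none), and $\mathrm{qpd}_R(0)=0$. The quasi-global dimension of a left Noetherian ring $R$ is $\mathrm{qgldim}(R)=\sup\{\mathrm{qpd}_R(M): M \text{ a finitely presented left } R\text{-module}\}$. Then $A$ is a local, finite-dimensional symmetric $K$-algebra and $$\mathrm{qgldim}(A)=\infty .$$ More precisely, there is a finitely generated non-projective left $A$-module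 $I_0$ such that $\mathrm{Ext}_A^i(I_0,I_0)=0$ for all $i\ge 2$ and $\mathrm{qpd}_A(I_0)=\infty$. -/

import Mathlib

open CategoryTheory

universe u

namespace QuasiProjective

variable {R : Type u} [Ring R]

/-- `P` (homologically graded: `d i : P i ⟶ P (i - 1)`) is a finite quasi-projective resolution of
the left module `M`: a bounded complex of projective modules such that every homology module is
isomorphic to a finite power of `M`, not all exponents being zero. The condition on degrees below
the support of `P` is harmless, because the homology vanishes there. The notion is only used
for `M ≠ 0`. -/
structure IsFiniteResolution (P : ChainComplex (ModuleCat.{u} R) ℤ) (M : ModuleCat.{u} R) :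
    Prop where
  projective : ∀ i : ℤ, Module.Projective R (P.X i)
  bounded_below : ∃ a : ℤ, ∀ i < a, Limits.IsZero (P.X i)
  bounded_above : ∃ b : ℤ, ∀ i > b, Limits.IsZero (P.X i)
  homology_power : ∃ n : ℤ → ℕ, (∃ j, n j ≠ 0) ∧
    ∀ j : ℤ, Nonempty (P.homology j ≃ₗ[R] (Fin (n j) → M))

/-- `s` is the supremum of the complex `P`: the largest degree with a nonzero term. -/
def IsSup (P : ChainComplex (ModuleCat.{u} R) ℤ) (s : ℤ) : Prop :=
  IsGreatest {i : ℤ | ¬ Limits.IsZero (P.X i)} s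

/-- `h` is the homological supremum of `P`: the largest degree with nonzero homology. -/
def IsHSup (P : ChainComplex (ModuleCat.{u} R) ℤ) (h : ℤ) : Prop :=
  IsGreatest {i : ℤ | ¬ Limits.IsZero (P.homology i)} h

open Classical in
/-- The quasi-projective dimension of a left module: `0` for the zero module, and otherwise the
infimum of `sup P - hsup P` over all finite quasi-projective resolutions `P` of `M` (so `⊤` if there
is none). For such `P` both suprema exist and `hsup P ≤ sup P`, so the difference is a natural
number. -/
noncomputable def qpd (M : ModuleCat.{u} R) : ℕ∞ :=
  if Limits.IsZero M then 0 else
    sInf {d : ℕ∞ | ∃ P : ChainComplex (ModuleCat.{u} R) ℤ, IsFiniteResolution P M ∧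
      ∃ (s h : ℤ) (n : ℕ), IsSup P s ∧ IsHSup P h ∧ (n : ℤ) = s - h ∧ d = (n : ℕ∞)}

/-- The quasi-global dimension of a (left Noetherian) ring: the supremum of the quasi-projective
dimensions of its finitely presented left modules. -/
noncomputable def qgldim (R : Type u) [Ring R] : ℕ∞ :=
  ⨆ (M : ModuleCat.{u} R) (_ : Module.FinitePresentation R M), qpd M

end QuasiProjective

/-- A finite-dimensional `K`-algebra is symmetric if it has a nondegenerate symmetric associative
bilinear form, that is, a linear form `t` such that `(a, b) ↦ t (a * b)` is symmetric and
nondegenerate. -/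
def IsSymmetricAlg (K A : Type*) [Field K] [Ring A] [Algebra K A] : Prop :=
  Module.Finite K A ∧ ∃ t : A →ₗ[K] K, (∀ a b : A, t (a * b) = t (b * a)) ∧
    ∀ a : A, (∀ b : A, t (a * b) = 0) → a = 0

/-- The defining relations `x_i² = 0` and `x_{i+1} x_i + q x_i x_{i+1} = 0`,
with indices `i = 0, 1, 2` read modulo `3`. -/
inductive LiuSchulzRel (K : Type u) [Field K] (q : K) :
    FreeAlgebra K (Fin 3) → FreeAlgebra K (Fin 3) → Prop
  | sq (i : Fin 3) : LiuSchulzRel K q (FreeAlgebra.ι K i * FreeAlgebra.ι K i) 0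
  | comm (i : Fin 3) : LiuSchulzRel K q
      (FreeAlgebra.ι K (i + 1) * FreeAlgebra.ι K i +
        q • (FreeAlgebra.ι K i * FreeAlgebra.ι K (i + 1))) 0

/-- The Liu–Schulz algebra: the quotient of the free algebra on `x_0, x_1, x_2` by the two-sided
ideal generated by the relations. -/
abbrev LiuSchulzAlgebra (K : Type u) [Field K] (q : K) : Type u :=
  RingQuot (LiuSchulzRel K q)

/-! Put `v k = x₀ + q⁻ᵏ x₁` and `I₀ = A v₀`. The left annihilator of `v k` is `A v_{k+1}`, so right
multiplications by the `v k` resolve `I₀`, and for `k ≥ 1` the condition `ExactMul (v (k + 1)) (v k)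
N` says `Ext^k(I₀, N) = 0`. It holds for `N = A` when `k ≥ 1`, and for `N = I₀` when `k ≥ 2` because
`q` is not a root of unity.

Let `P` be a finite quasi-projective resolution of `M = I₀`, with cycles `Z`, boundaries `B` and
homology `H`. Descending through `B_i → Z_i → H_i` and `Z_i → P_i → B_{i-1}` gives `Ext^k(M, B_j) =
0` for all `k ≥ 1` (`exactMul_boundaries`). Hence maps `M → H_j` lift to `Z_j`. Ascending from the
bottom, if `Z_j` is projective and `H_j ≠ 0`, then `M` is a summand of `Z_j`, hence projective,
which is false. So `H_j = 0`, the surjection `P_{j+1} → Z_j` splits, and `Z_{j+1}` is projective.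
All homology vanishes, a contradiction (`IsFiniteResolution.projective_of_exactMul`). -/

namespace LiuSchulz

/-! ### Monomial basis and multiplication table -/

section Coordinates

variable {K : Type u} [Field K] (q : K)

/-- Left multiplication by the generators, in coordinates with respect to the basis
`1, x₀, x₁, x₂, x₀x₁, x₁x₂, x₂x₀, x₀x₁x₂`. -/
def leftFun : Fin 3 → (Fin 8 → K) → (Fin 8 → K) := ![
  fun v => ![0, v 0, 0, 0, v 2, 0, -q * v 3, v 5],
  fun v => ![0, 0, v 0, 0, -q * v 1, v 3, 0, v 6],
  fun v => ![0, 0, 0, v 0, 0, -q * v 2, v 1, v 4]]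

/-- Left multiplication by the generators, as linear endomorphisms of the coordinate space. -/
def leftEnd (i : Fin 3) : Module.End K (Fin 8 → K) where
  toFun := leftFun q i
  map_add' v w := by
    fin_cases i <;> ext j <;> fin_cases j <;> simp [leftFun] <;> ring
  map_smul' c v := by
    fin_cases i <;> ext j <;> fin_cases j <;> simp [leftFun] <;> ring

lemma leftEnd_apply (i : Fin 3) (v : Fin 8 → K) : leftEnd q i v = leftFun q i v := rfl

/-- The left regular representation of the Liu–Schulz algebra in coordinates. -/
noncomputable def regular : LiuSchulzAlgebra K q →ₐ[K] Module.End K (Fin 8 → K) :=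
  RingQuot.liftAlgHom K ⟨FreeAlgebra.lift K (leftEnd q), by
    rintro _ _ (i | i)
    · simp only [map_mul, FreeAlgebra.lift_ι_apply, map_zero]
      ext1 v
      fin_cases i <;> ext j <;> fin_cases j <;> simp [leftEnd_apply, leftFun]
    · simp only [map_mul, map_add, map_smul, FreeAlgebra.lift_ι_apply, map_zero]
      apply LinearMap.ext
      intro v
      fin_cases i <;> ext j <;> fin_cases j <;> simp [leftEnd_apply, leftFun]⟩

/-- The generators of the Liu–Schulz algebra. -/
noncomputable def gen (i : Fin 3) : LiuSchulzAlgebra K q :=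
  RingQuot.mkAlgHom K (LiuSchulzRel K q) (FreeAlgebra.ι K i)

lemma regular_gen (i : Fin 3) : regular q (gen q i) = leftEnd q i := by
  simp [regular, gen]

lemma gen_mul_self (i : Fin 3) : gen q i * gen q i = 0 := by
  simpa [gen] using RingQuot.mkAlgHom_rel K (LiuSchulzRel.sq (q := q) i)

lemma gen_succ_mul (i : Fin 3) : gen q (i + 1) * gen q i = -q • (gen q i * gen q (i + 1)) := by
  have h := RingQuot.mkAlgHom_rel K (LiuSchulzRel.comm (q := q) i)
  have h' : gen q (i + 1) * gen q i + q • (gen q i * gen q (i + 1)) = 0 := by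
    simpa [gen] using h
  rw [eq_neg_of_add_eq_zero_left h']
  module

/-- Induction principle for the Liu–Schulz algebra. -/
lemma induction_gen {p : LiuSchulzAlgebra K q → Prop} (hg : ∀ i, p (gen q i))
    (hs : ∀ c : K, p (algebraMap K _ c)) (ha : ∀ a b, p a → p b → p (a + b))
    (hm : ∀ a b, p a → p b → p (a * b)) (a : LiuSchulzAlgebra K q) : p a := by
  obtain ⟨a, rfl⟩ := RingQuot.mkAlgHom_surjective K (LiuSchulzRel K q) a
  induction a using FreeAlgebra.induction with
  | grade0 c => simpa using hs c
  | grade1 i => exact hg i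
  | mul a b h₁ h₂ => rw [map_mul]; exact hm _ _ h₁ h₂
  | add a b h₁ h₂ => rw [map_add]; exact ha _ _ h₁ h₂

/-- The element with given coordinates. -/
noncomputable def ofCoord : (Fin 8 → K) →ₗ[K] LiuSchulzAlgebra K q :=
  Fintype.linearCombination K ![1, gen q 0, gen q 1, gen q 2, gen q 0 * gen q 1,
    gen q 1 * gen q 2, gen q 2 * gen q 0, gen q 0 * gen q 1 * gen q 2]

lemma ofCoord_apply (v : Fin 8 → K) : ofCoord q v = v 0 • 1 + v 1 • gen q 0 + v 2 • gen q 1 +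
    v 3 • gen q 2 + v 4 • (gen q 0 * gen q 1) + v 5 • (gen q 1 * gen q 2) +
    v 6 • (gen q 2 * gen q 0) + v 7 • (gen q 0 * gen q 1 * gen q 2) := by
  simp [ofCoord, Fintype.linearCombination_apply, Fin.sum_univ_eight]

variable {q}

/-- After scaling by `-q`, both sides are rewritings of `x₁x₀x₂`. -/
lemma gen_cycle₁ (hq0 : q ≠ 0) : gen q 1 * (gen q 2 * gen q 0) = gen q 0 * gen q 1 * gen q 2 := by
  have h₁ : gen q 1 * gen q 0 = -q • (gen q 0 * gen q 1) := gen_succ_mul q 0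
  have h₂ : gen q 0 * gen q 2 = -q • (gen q 2 * gen q 0) := gen_succ_mul q 2
  have h : -q • (gen q 1 * (gen q 2 * gen q 0)) = -q • (gen q 0 * gen q 1 * gen q 2) := by
    rw [← mul_smul_comm, ← h₂, ← smul_mul_assoc, ← h₁, mul_assoc]
  exact smul_right_injective _ (neg_ne_zero.2 hq0) h

lemma gen_cycle₂ (hq0 : q ≠ 0) : gen q 2 * (gen q 0 * gen q 1) = gen q 0 * gen q 1 * gen q 2 := by
  have h₁ : gen q 2 * gen q 1 = -q • (gen q 1 * gen q 2) := gen_succ_mul q 1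
  have h₂ : gen q 0 * gen q 2 = -q • (gen q 2 * gen q 0) := gen_succ_mul q 2
  have h : -q • (gen q 2 * (gen q 0 * gen q 1)) = -q • (gen q 0 * gen q 1 * gen q 2) := by
    rw [mul_assoc (gen q 0), ← mul_smul_comm (-q) (gen q 0), ← h₁, ← mul_assoc, ← mul_assoc, h₂,
      smul_mul_assoc]
  exact smul_right_injective _ (neg_ne_zero.2 hq0) h

lemma gen_mul_ofCoord (hq0 : q ≠ 0) (i : Fin 3) (v : Fin 8 → K) :
    gen q i * ofCoord q v = ofCoord q (leftFun q i v) := by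
  have s₀ := gen_mul_self q 0
  have s₁ := gen_mul_self q 1
  have s₂ := gen_mul_self q 2
  have c₀ : gen q 1 * gen q 0 = -q • (gen q 0 * gen q 1) := gen_succ_mul q 0
  have c₁ : gen q 2 * gen q 1 = -q • (gen q 1 * gen q 2) := gen_succ_mul q 1
  have c₂ : gen q 0 * gen q 2 = -q • (gen q 2 * gen q 0) := gen_succ_mul q 2
  have z₁ := gen_cycle₁ hq0
  have z₂ := gen_cycle₂ hq0
  have t₁ : gen q 0 * (gen q 2 * gen q 0) = 0 := by
    rw [← mul_assoc, c₂, smul_mul_assoc, mul_assoc, s₀, mul_zero, smul_zero]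
  have t₂ : gen q 1 * (gen q 0 * gen q 1) = 0 := by
    rw [← mul_assoc, c₀, smul_mul_assoc, mul_assoc, s₁, mul_zero, smul_zero]
  have t₃ : gen q 2 * (gen q 1 * gen q 2) = 0 := by
    rw [← mul_assoc, c₁, smul_mul_assoc, mul_assoc, s₂, mul_zero, smul_zero]
  have t₄ : gen q 0 * (gen q 0 * gen q 1) = 0 := by rw [← mul_assoc, s₀, zero_mul]
  have t₅ : gen q 1 * (gen q 1 * gen q 2) = 0 := by rw [← mul_assoc, s₁, zero_mul]
  have t₆ : gen q 2 * (gen q 2 * gen q 0) = 0 := by rw [← mul_assoc, s₂, zero_mul]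
  have w₀ : gen q 0 * (gen q 0 * gen q 1 * gen q 2) = 0 := by rw [← mul_assoc, t₄, zero_mul]
  have w₁ : gen q 1 * (gen q 0 * gen q 1 * gen q 2) = 0 := by rw [← mul_assoc, t₂, zero_mul]
  have w₂ : gen q 2 * (gen q 0 * gen q 1 * gen q 2) = 0 := by
    rw [← z₂, ← mul_assoc, s₂, zero_mul]
  fin_cases i <;>
  simp [leftFun, ofCoord_apply, mul_add, s₀, s₁, s₂, c₀, c₁, c₂, z₁, z₂, t₁, t₂, t₃, t₄, t₅, t₆,
    w₀, w₁, w₂, ← mul_assoc (gen q 0) (gen q 1) (gen q 2)] <;> module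

lemma ofCoord_regular (hq0 : q ≠ 0) (a : LiuSchulzAlgebra K q) (v : Fin 8 → K) :
    ofCoord q (regular q a v) = a * ofCoord q v := by
  induction a using induction_gen generalizing v with
  | hg i => rw [regular_gen, leftEnd_apply, gen_mul_ofCoord hq0]
  | hs c => simp [Module.algebraMap_end_apply, ← Algebra.smul_def]
  | ha a b h₁ h₂ => simp [h₁, h₂, add_mul]
  | hm a b h₁ h₂ => simp [h₁, h₂, mul_assoc]

/-- The Liu–Schulz algebra is eight-dimensional, with the expected monomial basis. -/
noncomputable def coord (hq0 : q ≠ 0) : LiuSchulzAlgebra K q ≃ₗ[K] (Fin 8 → K) :=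
  -- The inverse of `ofCoord` applies the regular representation to the coordinate vector of `1`.
  LinearEquiv.symm <| LinearEquiv.ofLinearMap (ofCoord q)
    ((LinearMap.applyₗ ![1, 0, 0, 0, 0, 0, 0, 0]).comp (regular q).toLinearMap)
    (by
      apply LinearMap.ext
      intro a
      simp only [LinearMap.comp_apply, AlgHom.toLinearMap_apply, LinearMap.applyₗ_apply_apply,
        ofCoord_regular hq0]
      simp [ofCoord_apply])
    (by
      apply LinearMap.ext
      intro v
      simp only [LinearMap.comp_apply, ofCoord_apply, AlgHom.toLinearMap_apply, map_add, map_smul,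
        map_mul, map_one, regular_gen, LinearMap.applyₗ_apply_apply, Module.End.mul_apply, Module.End.one_apply, leftEnd_apply]
      ext j
      fin_cases j <;> simp [leftFun])

lemma coord_ofCoord (hq0 : q ≠ 0) (v : Fin 8 → K) : coord hq0 (ofCoord q v) = v :=
  (coord hq0).apply_symm_apply v

lemma ofCoord_coord (hq0 : q ≠ 0) (a : LiuSchulzAlgebra K q) : ofCoord q (coord hq0 a) = a :=
  (coord hq0).symm_apply_apply a

lemma coord_gen_mul (hq0 : q ≠ 0) (i : Fin 3) (a : LiuSchulzAlgebra K q) :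
    coord hq0 (gen q i * a) = leftFun q i (coord hq0 a) := by
  rw [← coord_ofCoord hq0 (leftFun q i _), ← gen_mul_ofCoord hq0, ofCoord_coord]

lemma coord_mul (hq0 : q ≠ 0) (a b : LiuSchulzAlgebra K q) :
    coord hq0 (a * b) =
      let v := coord hq0 a
      let w := coord hq0 b
      ![v 0 * w 0, v 0 * w 1 + v 1 * w 0, v 0 * w 2 + v 2 * w 0, v 0 * w 3 + v 3 * w 0,
        v 0 * w 4 + v 4 * w 0 + v 1 * w 2 - q * v 2 * w 1,
        v 0 * w 5 + v 5 * w 0 + v 2 * w 3 - q * v 3 * w 2,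
        v 0 * w 6 + v 6 * w 0 + v 3 * w 1 - q * v 1 * w 3,
        v 0 * w 7 + v 7 * w 0 + v 1 * w 5 + v 2 * w 6 + v 3 * w 4 + v 4 * w 3 + v 5 * w 1 +
          v 6 * w 2] := by
  conv_lhs => rw [← ofCoord_coord hq0 a]
  simp only [ofCoord_apply, add_mul, smul_mul_assoc, one_mul, map_add, map_smul, mul_assoc,
    coord_gen_mul]
  ext j
  simp only [Pi.add_apply, Pi.smul_apply, smul_eq_mul]
  fin_cases j <;> simp [leftFun] <;> ring

lemma coord_one (hq0 : q ≠ 0) : coord hq0 1 = ![1, 0, 0, 0, 0, 0, 0, 0] := by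
  rw [← coord_ofCoord hq0 ![1, 0, 0, 0, 0, 0, 0, 0]]
  simp [ofCoord_apply]

/-! ### Symmetric and local structure -/

lemma finite (hq0 : q ≠ 0) : Module.Finite K (LiuSchulzAlgebra K q) :=
  Module.Finite.equiv (coord hq0).symm

lemma isSymmetricAlg (hq0 : q ≠ 0) : IsSymmetricAlg K (LiuSchulzAlgebra K q) := by
  -- The form is the coefficient of `x₀x₁x₂`; it pairs each monomial with the complementary one,
  -- which is the test vector used below.
  refine ⟨finite hq0, LinearMap.proj 7 ∘ₗ (coord hq0).toLinearMap, fun a b => ?_, fun a h => ?_⟩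
  · simp [coord_mul]
    ring
  · have h' (w : Fin 8 → K) := h (ofCoord q w)
    simp only [LinearMap.comp_apply, LinearEquiv.coe_coe, LinearMap.proj_apply, coord_mul,
      coord_ofCoord] at h'
    apply (coord hq0).injective
    ext j
    fin_cases j
    · simpa using h' ![0, 0, 0, 0, 0, 0, 0, 1]
    · simpa using h' ![0, 0, 0, 0, 0, 1, 0, 0]
    · simpa using h' ![0, 0, 0, 0, 0, 0, 1, 0]
    · simpa using h' ![0, 0, 0, 0, 1, 0, 0, 0]
    · simpa using h' ![0, 0, 0, 1, 0, 0, 0, 0]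
    · simpa using h' ![0, 1, 0, 0, 0, 0, 0, 0]
    · simpa using h' ![0, 0, 1, 0, 0, 0, 0, 0]
    · simpa using h' ![1, 0, 0, 0, 0, 0, 0, 0]

/-- Left multiplication by `a` is triangular for the degree grading, hence injective, hence
surjective by finite dimension. -/
lemma exists_mul_eq_one (hq0 : q ≠ 0) {a : LiuSchulzAlgebra K q} (ha : coord hq0 a 0 ≠ 0) :
    ∃ b, a * b = 1 := by
  have := finite hq0
  have hinj : Function.Injective (LinearMap.mulLeft K a) := by
    rw [injective_iff_map_eq_zero]
    intro b hb
    have h := coord_mul hq0 a b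
    rw [show a * b = 0 from hb, map_zero] at h
    have h₀ : coord hq0 b 0 = 0 := by simpa [ha] using (congrFun h 0).symm
    have h₁ : coord hq0 b 1 = 0 := by simpa [ha, h₀] using (congrFun h 1).symm
    have h₂ : coord hq0 b 2 = 0 := by simpa [ha, h₀] using (congrFun h 2).symm
    have h₃ : coord hq0 b 3 = 0 := by simpa [ha, h₀] using (congrFun h 3).symm
    have h₄ : coord hq0 b 4 = 0 := by simpa [ha, h₀, h₁, h₂, h₃] using (congrFun h 4).symm
    have h₅ : coord hq0 b 5 = 0 := by simpa [ha, h₀, h₁, h₂, h₃] using (congrFun h 5).symm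
    have h₆ : coord hq0 b 6 = 0 := by simpa [ha, h₀, h₁, h₂, h₃] using (congrFun h 6).symm
    have h₇ : coord hq0 b 7 = 0 := by
      simpa [ha, h₀, h₁, h₂, h₃, h₄, h₅, h₆] using (congrFun h 7).symm
    apply (coord hq0).injective
    ext j
    fin_cases j <;> simpa
  exact LinearMap.surjective_of_injective hinj 1

lemma isUnit_of_coord_ne_zero (hq0 : q ≠ 0) {a : LiuSchulzAlgebra K q} (ha : coord hq0 a 0 ≠ 0) :
    IsUnit a := by
  obtain ⟨b, hab⟩ := exists_mul_eq_one hq0 ha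
  have hb : coord hq0 b 0 ≠ 0 := by
    intro hb
    simpa [coord_mul, coord_one, hb] using congrFun (congrArg (coord hq0) hab) 0
  obtain ⟨c, hbc⟩ := exists_mul_eq_one hq0 hb
  have : a = c := by rw [← mul_one a, ← hbc, ← mul_assoc, hab, one_mul]
  exact ⟨⟨a, b, hab, this ▸ hbc⟩, rfl⟩

lemma isLocalRing (hq0 : q ≠ 0) : IsLocalRing (LiuSchulzAlgebra K q) where
  exists_pair_ne := ⟨0, 1, fun h => by
    simpa [coord_one] using congrFun (congrArg (coord hq0) h) 0⟩
  isUnit_or_isUnit_of_add_one {a b} hab := by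
    by_cases ha : coord hq0 a 0 = 0
    · refine Or.inr (isUnit_of_coord_ne_zero hq0 fun hb => ?_)
      simpa [coord_one, ha, hb] using congrFun (congrArg (coord hq0) hab) 0
    · exact Or.inl (isUnit_of_coord_ne_zero hq0 ha)

end Coordinates

end LiuSchulz

/-! ### Ext vanishing as exactness of multiplications -/

namespace QuasiProjective

section Annihilation

variable {R : Type u} [Ring R]

/-- `a • n = 0` forces `n ∈ b • N`: the complex `N --b--> N --a--> N` is exact in the middle. -/
def ExactMul (a b : R) (N : Type*) [AddCommGroup N] [Module R N] : Prop :=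
  ∀ n : N, a • n = 0 → ∃ m : N, n = b • m

lemma ExactMul.of_projective {a b : R} (h : ExactMul a b R) (P : Type*) [AddCommGroup P]
    [Module R P] [Module.Projective R P] : ExactMul a b P := by
  intro n hn
  obtain ⟨s, hs⟩ := Module.projective_def.1 (inferInstance : Module.Projective R P)
  have h₁ (x : P) : a • (s n) x = 0 := by
    rw [← Finsupp.smul_apply, ← map_smul, hn, map_zero, Finsupp.zero_apply]
  choose c hc using fun x => h _ (h₁ x)
  refine ⟨∑ x ∈ (s n).support, c x • x, ?_⟩
  conv_lhs => rw [← hs n]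
  simp only [Finsupp.linearCombination_apply, Finsupp.sum, id, Finset.smul_sum, smul_smul]
  refine Finset.sum_congr rfl fun x _ => ?_
  rw [hc x, smul_eq_mul]

lemma ExactMul.pi {a b : R} {M : Type*} [AddCommGroup M] [Module R M] (h : ExactMul a b M)
    (ι : Type*) : ExactMul a b (ι → M) := by
  intro n hn
  choose m hm using fun i => h (n i) (congrFun hn i)
  exact ⟨m, funext hm⟩

lemma ExactMul.of_equiv {a b : R} {M N : Type*} [AddCommGroup M] [Module R M] [AddCommGroup N]
    [Module R N] (h : ExactMul a b M) (e : N ≃ₗ[R] M) : ExactMul a b N := by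
  intro n hn
  obtain ⟨m, hm⟩ := h (e n) (by rw [← map_smul, hn, map_zero])
  exact ⟨e.symm m, e.injective (by rw [hm, map_smul, e.apply_symm_apply])⟩

/-- The middle term of the long exact sequence: `Ext^k` vanishes on `Z` when it does on the kernel
and on `H`. -/
lemma ExactMul.extension {a b : R} (hab : a * b = 0) {Z H : Type*} [AddCommGroup Z] [Module R Z]
    [AddCommGroup H] [Module R H] {p : Z →ₗ[R] H} (hp : Function.Surjective p)
    (hB : ExactMul a b (LinearMap.ker p)) (hH : ExactMul a b H) : ExactMul a b Z := by
  intro z hz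
  obtain ⟨h, hh⟩ := hH (p z) (by rw [← map_smul, hz, map_zero])
  obtain ⟨y, rfl⟩ := hp h
  obtain ⟨w, hw⟩ := hB ⟨z - b • y, by simp [hh]⟩
    (by ext; simp [smul_sub, hz, smul_smul, hab])
  refine ⟨w + y, ?_⟩
  have := congrArg Subtype.val hw
  rw [Submodule.coe_smul] at this
  rw [smul_add, ← this, sub_add_cancel]

/-- Dimension shift: `Ext^k` on `B` is squeezed between `Ext^k` on `P` and `Ext^{k+1}` on the
kernel. -/
lemma ExactMul.quotient {a b c : R} (hab : a * b = 0) {P B : Type*} [AddCommGroup P] [Module R P]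
    [AddCommGroup B] [Module R B] {p : P →ₗ[R] B} (hp : Function.Surjective p)
    (hZ : ExactMul a b (LinearMap.ker p)) (hP : ExactMul b c P) : ExactMul b c B := by
  intro y hy
  obtain ⟨x, rfl⟩ := hp y
  obtain ⟨z, hz⟩ := hZ ⟨b • x, by simp [hy]⟩ (by ext; simp [smul_smul, hab])
  have hz' : b • x = b • (z : P) := congrArg Subtype.val hz
  obtain ⟨w, hw⟩ := hP (x - z) (by rw [smul_sub, hz', sub_self])
  refine ⟨p w, ?_⟩
  rw [← map_smul, ← hw, map_sub, LinearMap.mem_ker.1 z.2, sub_zero]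

/-- A map out of a cyclic module `R m ≅ R / R b` lifts along a surjection `p` as soon as
multiplication by `a`, `b` is exact on the kernel of `p`. -/
lemma exists_lift_of_exactMul {a b : R} (hab : a * b = 0) {Z H M : Type*} [AddCommGroup Z]
    [Module R Z] [AddCommGroup H] [Module R H] [AddCommGroup M] [Module R M] {p : Z →ₗ[R] H}
    (hp : Function.Surjective p) (hB : ExactMul a b (LinearMap.ker p)) {m : M}
    (hm : ∀ x : M, ∃ r : R, r • m = x) (hann : ∀ r : R, r • m = 0 ↔ ∃ s, r = s * b)
    (f : M →ₗ[R] H) : ∃ g : M →ₗ[R] Z, p ∘ₗ g = f := by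
  obtain ⟨z, hz⟩ := hp (f m)
  have hbm : b • m = 0 := (hann b).2 ⟨1, (one_mul b).symm⟩
  -- The preimage `z` need not be killed by `b`; exactness on the kernel supplies `w` such that `z -
  -- w` is.
  obtain ⟨w, hw⟩ := hB ⟨b • z, by simp [hz, ← map_smul, hbm]⟩ (by ext; simp [smul_smul, hab])
  have hw' : b • z = b • (w : Z) := congrArg Subtype.val hw
  have hle : LinearMap.ker (LinearMap.toSpanSingleton R M m) ≤
      LinearMap.ker (LinearMap.toSpanSingleton R Z (z - w)) := by
    intro r hr
    obtain ⟨s, rfl⟩ := (hann r).1 hr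
    simp [mul_smul, smul_sub, hw']
  let e := (LinearMap.toSpanSingleton R M m).quotKerEquivOfSurjective hm
  refine ⟨(Submodule.liftQ _ _ hle) ∘ₗ e.symm.toLinearMap, LinearMap.ext fun x => ?_⟩
  obtain ⟨r, rfl⟩ := hm x
  have he : e.symm (r • m) = Submodule.Quotient.mk r := by
    rw [LinearEquiv.symm_apply_eq]
    rfl
  have hw₀ : p w = 0 := w.2
  rw [LinearMap.comp_apply, LinearMap.comp_apply, LinearEquiv.coe_coe, he, Submodule.liftQ_apply]
  simp [hz, hw₀]

lemma projective_ker_of_surjective {P B : Type*} [AddCommGroup P] [Module R P]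
    [AddCommGroup B] [Module R B] [Module.Projective R P] [Module.Projective R B] {p : P →ₗ[R] B}
    (hp : Function.Surjective p) : Module.Projective R (LinearMap.ker p) := by
  obtain ⟨s, hs⟩ := Module.projective_lifting_property p LinearMap.id hp
  have hs' (y : B) : p (s y) = y := LinearMap.congr_fun hs y
  refine Module.Projective.of_split (LinearMap.ker p).subtype
    ((LinearMap.id - s ∘ₗ p).codRestrict (LinearMap.ker p) fun x => by simp [hs']) ?_
  ext x
  have hx : p x = 0 := x.2
  simp [hx]

end Annihilation

/-! ### Cycles, boundaries and homology -/

variable {R : Type u} [Ring R]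

lemma d_mem_ker (P : ChainComplex (ModuleCat.{u} R) ℤ) (i j k : ℤ) (x : P.X i) :
    (P.d i j).hom x ∈ LinearMap.ker (P.d j k).hom := by
  rw [LinearMap.mem_ker, ← LinearMap.comp_apply, ← ModuleCat.hom_comp, P.d_comp_d]
  rfl

/-- Homology of a short complex of modules as cycles modulo boundaries. -/
lemma exists_shortComplex_homology_projection (S : ShortComplex (ModuleCat.{u} R)) :
    ∃ π : LinearMap.ker S.g.hom →ₗ[R] S.homology, Function.Surjective π ∧
      ∀ z, π z = 0 ↔ ∃ y : S.X₁, S.f.hom y = z := by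
  let e : S.homology ≃ₗ[R] (LinearMap.ker S.g.hom ⧸ LinearMap.range S.moduleCatToCycles) :=
    S.moduleCatHomologyIso.toLinearEquiv
  refine ⟨e.symm.toLinearMap ∘ₗ Submodule.mkQ _,
    e.symm.surjective.comp (Submodule.mkQ_surjective _), fun z => ?_⟩
  rw [LinearMap.comp_apply, LinearEquiv.coe_coe, LinearEquiv.map_eq_zero_iff,
    Submodule.mkQ_apply, Submodule.Quotient.mk_eq_zero, LinearMap.mem_range]
  exact exists_congr fun y => Subtype.ext_iff

/-- Homology of a complex of modules as cycles modulo boundaries. -/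
lemma exists_homology_projection (P : ChainComplex (ModuleCat.{u} R) ℤ) {i j k : ℤ}
    (hi : j + 1 = i) (hk : k + 1 = j) :
    ∃ π : LinearMap.ker (P.d j k).hom →ₗ[R] P.homology j, Function.Surjective π ∧
      ∀ z, π z = 0 ↔ ∃ y : P.X i, (P.d i j).hom y = z := by
  obtain ⟨π, hπ, h⟩ := exists_shortComplex_homology_projection (P.sc' i j k)
  let e := (P.homologyIsoSc' i j k (by simpa using hi) (by simp [← hk])).toLinearEquiv
  exact ⟨e.symm.toLinearMap ∘ₗ π, e.symm.surjective.comp hπ,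
    fun z => (e.symm.map_eq_zero_iff (x := π z)).trans (h z)⟩

/-- Transfer of `ExactMul` from the boundaries in a chain module to the boundaries in the cycles. -/
lemma ExactMul.of_range {a b : R} {X Y H : Type*} [AddCommGroup X] [Module R X] [AddCommGroup Y]
    [Module R Y] [AddCommGroup H] [Module R H] {d : X →ₗ[R] Y} {Z : Submodule R Y}
    (h : ExactMul a b (LinearMap.range d)) (hd : ∀ x, d x ∈ Z)
    (π : Z →ₗ[R] H) (hker : ∀ z, π z = 0 ↔ ∃ y, d y = z) : ExactMul a b (LinearMap.ker π) := by
  rintro ⟨z, hz⟩ hn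
  obtain ⟨y, hy⟩ := (hker z).1 hz
  obtain ⟨⟨_, x, rfl⟩, hw⟩ := h ⟨_, y, hy⟩ (Subtype.ext (congrArg (fun t => t.1.1) hn))
  refine ⟨⟨⟨d x, hd x⟩, (hker _).2 ⟨x, rfl⟩⟩, Subtype.ext (Subtype.ext ?_)⟩
  have h' := congrArg Subtype.val hw
  exact h'

/-! ### Obstruction to finite quasi-projective resolutions -/

section Resolution

variable {v : ℕ → R} {M : ModuleCat.{u} R} {P : ChainComplex (ModuleCat.{u} R) ℤ}

lemma exactMul_boundaries (hv : ∀ k, v (k + 1) * v k = 0)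
    (hR : ∀ k, 1 ≤ k → ExactMul (v (k + 1)) (v k) R)
    (hM : ∀ k, 2 ≤ k → ExactMul (v (k + 1)) (v k) M) (hP : IsFiniteResolution P M)
    (i j : ℤ) (hij : j + 1 = i) (k : ℕ) (hk : 1 ≤ k) :
    ExactMul (v (k + 1)) (v k) (LinearMap.range (P.d i j).hom) := by
  obtain ⟨b, hb⟩ := hP.bounded_above
  obtain ⟨n, -, hn⟩ := hP.homology_power
  have of_gt (i j : ℤ) (h : b < i) (k : ℕ) :
      ExactMul (v (k + 1)) (v k) (LinearMap.range (P.d i j).hom) := by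
    have := ModuleCat.subsingleton_of_isZero (hb i h)
    rintro ⟨_, x, rfl⟩ -
    refine ⟨0, Subtype.ext ?_⟩
    simp [Subsingleton.elim x 0]
  -- Descending induction on the degree; `N` bounds the distance to the top of the complex.
  suffices key : ∀ (N : ℕ) (i j : ℤ), j + 1 = i → b < i + N → ∀ k, 1 ≤ k →
      ExactMul (v (k + 1)) (v k) (LinearMap.range (P.d i j).hom) from
    key (b + 1 - i).toNat i j hij (by omega) k hk
  intro N
  induction N with
  | zero => exact fun i j _ h k _ => of_gt i j (by simpa using h) k
  | succ N ih =>
    rintro i j hij h k hk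
    obtain ⟨π, hπ, hker⟩ := exists_homology_projection P (i := i + 1) rfl hij
    have hB (k : ℕ) (hk : 1 ≤ k) : ExactMul (v (k + 1)) (v k) (LinearMap.ker π) :=
      (ih (i + 1) i rfl (by push_cast at h; omega) k hk).of_range (d_mem_ker P _ _ _) π hker
    -- The index `k + 1 ≥ 2` is in the range where `hM` applies; passing to the quotient `B` brings
    -- it back down to `k`.
    have hZ : ExactMul (v (k + 1 + 1)) (v (k + 1)) (LinearMap.ker (P.d i j).hom) :=
      .extension (hv _) hπ (hB _ (by omega))
        (((hM _ (by omega)).pi _).of_equiv (hn i).some)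
    have := hP.projective i
    rw [← LinearMap.ker_rangeRestrict] at hZ
    exact .quotient (hv _) (LinearMap.surjective_rangeRestrict _) hZ ((hR k hk).of_projective _)

/-- Let `M = R m` with `m` having annihilator `R v₁`, and suppose that multiplication by the `v k`
computes a resolution of `M` for which `Ext^k(M, R) = 0` for `k ≥ 1` and `Ext^k(M, M) = 0` for
`k ≥ 2`. Then `M` has a finite quasi-projective resolution only if it is projective. -/
theorem IsFiniteResolution.projective_of_exactMul (hP : IsFiniteResolution P M)
    (hv : ∀ k, v (k + 1) * v k = 0) (hR : ∀ k, 1 ≤ k → ExactMul (v (k + 1)) (v k) R)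
    (hM : ∀ k, 2 ≤ k → ExactMul (v (k + 1)) (v k) M) {m : M}
    (hm : ∀ x : M, ∃ r : R, r • m = x) (hann : ∀ r : R, r • m = 0 ↔ ∃ s, r = s * v 1) :
    Module.Projective R M := by
  by_contra hproj
  obtain ⟨a, ha⟩ := hP.bounded_below
  obtain ⟨n, ⟨j₀, hj₀⟩, hn⟩ := hP.homology_power
  have homology_zero (j k : ℤ) (hk : k + 1 = j)
      (hZ : Module.Projective R (LinearMap.ker (P.d j k).hom)) : n j = 0 := by
    by_contra hnj
    obtain ⟨π, hπ, hker⟩ := exists_homology_projection P (i := j + 1) rfl hk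
    let e := (hn j).some
    let t : Fin (n j) := ⟨0, Nat.pos_of_ne_zero hnj⟩
    -- Lifting one copy of `M` in the homology to the projective cycles exhibits `M` as a direct
    -- summand of them.
    obtain ⟨g, hg⟩ := exists_lift_of_exactMul (hv 1) hπ
      ((exactMul_boundaries hv hR hM hP (j + 1) j rfl 1 le_rfl).of_range (d_mem_ker P _ _ _) π hker) hm hann
      (e.symm.toLinearMap ∘ₗ LinearMap.single R (fun _ => M) t)
    refine hproj (Module.Projective.of_split g (LinearMap.proj t ∘ₗ e.toLinearMap ∘ₗ π) ?_)
    ext x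
    have := LinearMap.congr_fun hg x
    simp only [LinearMap.comp_apply] at this
    simp [this]
  have cycles_projective : ∀ (N : ℕ) (j k : ℤ), k + 1 = j → j < a + N →
      Module.Projective R (LinearMap.ker (P.d j k).hom) := by
    intro N
    induction N with
    | zero =>
      intro j k _ h
      have := ModuleCat.subsingleton_of_isZero (ha j (by simpa using h))
      infer_instance
    | succ N ih =>
      rintro j k hk h
      have hZ := ih k (k - 1) (by omega) (by push_cast at h; omega)
      obtain ⟨π, hπ, hker⟩ := exists_homology_projection P (i := j) hk (sub_add_cancel k 1)
      -- Vanishing homology makes `P_j → Z_k` surjective, so its kernel `Z_j` is projective.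
      have := (hn k).some.toEquiv.subsingleton_congr.2 (by
        rw [homology_zero k (k - 1) (by omega) hZ]; infer_instance)
      have hP' := hP.projective j
      have := projective_ker_of_surjective
        (p := (P.d j k).hom.codRestrict _ (d_mem_ker P j k (k - 1))) fun z => by
          obtain ⟨y, hy⟩ := (hker z).1 (Subsingleton.elim _ _)
          exact ⟨y, Subtype.ext hy⟩
      rwa [LinearMap.ker_codRestrict] at this
  exact hj₀ (homology_zero j₀ (j₀ - 1) (by omega)
    (cycles_projective (j₀ + 1 - a).toNat _ _ (by omega) (by omega)))

/-- In the situation of `IsFiniteResolution.projective_of_exactMul`, a non-projective module has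
infinite quasi-projective dimension. -/
theorem qpd_eq_top (hproj : ¬ Module.Projective R M)
    (hv : ∀ k, v (k + 1) * v k = 0) (hR : ∀ k, 1 ≤ k → ExactMul (v (k + 1)) (v k) R)
    (hM : ∀ k, 2 ≤ k → ExactMul (v (k + 1)) (v k) M) {m : M}
    (hm : ∀ x : M, ∃ r : R, r • m = x) (hann : ∀ r : R, r • m = 0 ↔ ∃ s, r = s * v 1) :
    qpd M = ⊤ := by
  have hM₀ : ¬ Limits.IsZero M := fun h =>
    have := ModuleCat.subsingleton_of_isZero h
    hproj (@Module.Projective.of_free _ _ _ _ _ (Module.Free.of_subsingleton R M))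
  rw [qpd, if_neg hM₀, sInf_eq_top]
  rintro _ ⟨P, hP, -⟩
  exact absurd (hP.projective_of_exactMul hv hR hM hm hann) hproj

end Resolution

/-! ### Ext groups of cyclic left ideals -/

section CyclicIdeals

open Abelian

variable {v : ℕ → R}

/-- The left ideal generated by the `k`-th member of a sequence. -/
abbrev cyclicIdeal (v : ℕ → R) (k : ℕ) : Submodule R R := R ∙ v k

/-- Right multiplication by `v k`, as a map onto the left ideal generated by `v k`. -/
noncomputable def cover (v : ℕ → R) (k : ℕ) : R →ₗ[R] cyclicIdeal v k :=
  LinearMap.toSpanSingleton _ _ ⟨v k, Submodule.mem_span_singleton_self _⟩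

lemma coe_cover (k : ℕ) (a : R) : (cover v k a : R) = a * v k := rfl

lemma cover_surjective (k : ℕ) : Function.Surjective (cover v k) := by
  rintro ⟨_, h⟩
  obtain ⟨a, rfl⟩ := Submodule.mem_span_singleton.1 h
  exact ⟨a, rfl⟩

lemma exact_cover (hann : ∀ k r, r * v k = 0 ↔ ∃ s, r = s * v (k + 1)) (k : ℕ) :
    Function.Exact (cyclicIdeal v (k + 1)).subtype (cover v k) := by
  intro a
  rw [← Submodule.coe_eq_zero, coe_cover, hann]
  constructor
  · rintro ⟨b, rfl⟩
    exact ⟨⟨_, Submodule.smul_mem _ b (Submodule.mem_span_singleton_self _)⟩, rfl⟩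
  · rintro ⟨⟨_, h⟩, rfl⟩
    obtain ⟨b, rfl⟩ := Submodule.mem_span_singleton.1 h
    exact ⟨b, rfl⟩

/-- The short exact sequence `0 → R v_{k+1} → R → R v_k → 0`. -/
noncomputable abbrev syzygy (hann : ∀ k r, r * v k = 0 ↔ ∃ s, r = s * v (k + 1)) (k : ℕ) :
    ShortComplex (ModuleCat.{u} R) :=
  ModuleCat.shortComplexOfCompEqZero (cyclicIdeal v (k + 1)).subtype (cover v k)
    (exact_cover hann k).linearMap_comp_eq_zero

lemma syzygy_shortExact (hann : ∀ k r, r * v k = 0 ↔ ∃ s, r = s * v (k + 1)) (k : ℕ) :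
    (syzygy hann k).ShortExact :=
  ModuleCat.shortComplex_shortExact _ (exact_cover hann k) (Submodule.injective_subtype _)
    (cover_surjective k)

/-- The image of `v k` is killed by `v (k + 1)`, so it is `v k • w`; the extension sends `1` to `w`.
-/
lemma exists_extension (hv : ∀ k, v (k + 1) * v k = 0) {M : Type*} [AddCommGroup M] [Module R M]
    {k : ℕ} (hM : ExactMul (v (k + 1)) (v k) M) (f : cyclicIdeal v k →ₗ[R] M) :
    ∃ g : R →ₗ[R] M, f = g ∘ₗ (cyclicIdeal v k).subtype := by
  let m : cyclicIdeal v k := ⟨v k, Submodule.mem_span_singleton_self _⟩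
  have hm : v (k + 1) • m = 0 := Subtype.ext (hv k)
  obtain ⟨w, hw⟩ := hM (f m) (by rw [← map_smul, hm, map_zero])
  refine ⟨LinearMap.toSpanSingleton _ _ w, LinearMap.ext fun ⟨x, hx⟩ => ?_⟩
  obtain ⟨a, rfl⟩ := Submodule.mem_span_singleton.1 hx
  have : f ⟨a • v k, hx⟩ = a • f m := map_smul f a m
  exact this.trans (by rw [hw, smul_smul]; rfl)

/-- Dimension shifting along the syzygies lowers `n` and raises `k`, preserving `1 ≤ n + k`. At `n =
0`, every map from `R v_{k+1}` extends to `R`, with index `k + 1 ≥ 2`. -/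
lemma subsingleton_ext_cyclicIdeal (hv : ∀ k, v (k + 1) * v k = 0)
    (hann : ∀ k r, r * v k = 0 ↔ ∃ s, r = s * v (k + 1))
    {M : ModuleCat.{u} R} (hM : ∀ k, 2 ≤ k → ExactMul (v (k + 1)) (v k) M) (n : ℕ) :
    ∀ k : ℕ, 1 ≤ n + k → Subsingleton (Ext (ModuleCat.of R (cyclicIdeal v k)) M (n + 1)) := by
  have hproj (k : ℕ) : Projective (syzygy hann k).X₂ :=
    ModuleCat.projective_of_categoryTheory_projective (ModuleCat.of R R)
  induction n with
  | zero =>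
    refine fun k hk => subsingleton_of_forall_eq 0 fun x => ?_
    obtain ⟨y, rfl⟩ := Ext.contravariant_sequence_exact₃ (syzygy_shortExact hann k) _ x
      (Ext.eq_zero_of_projective _) (n₀ := 0) (by omega)
    obtain ⟨f, rfl⟩ := (Ext.mk₀_bijective _ _).2 y
    obtain ⟨g, rfl⟩ : ∃ g : (syzygy hann k).X₂ ⟶ _, f = (syzygy hann k).f ≫ g := by
      obtain ⟨g, hg⟩ := exists_extension hv (hM (k + 1) (by omega)) f.hom
      exact ⟨ModuleCat.ofHom g, ModuleCat.hom_ext hg⟩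
    rw [← Ext.mk₀_comp_mk₀]
    exact (syzygy_shortExact hann k).extClass_comp_assoc _
  | succ n ih =>
    refine fun k hk => subsingleton_of_forall_eq 0 fun x => ?_
    obtain ⟨y, rfl⟩ := Ext.contravariant_sequence_exact₃ (syzygy_shortExact hann k) _ x
      (Ext.eq_zero_of_projective _) (n₀ := n + 1) (by omega)
    have := ih (k + 1) (by omega)
    rw [Subsingleton.elim y 0, Ext.comp_zero]

end CyclicIdeals

end QuasiProjective

/-! ### The elements `x₀ + r x₁` and the ideal `I₀` -/

namespace LiuSchulz

open QuasiProjective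

variable {K : Type u} [Field K] {q : K}

/-- The element `x₀ + r x₁`. -/
noncomputable def lin (q r : K) : LiuSchulzAlgebra K q := gen q 0 + r • gen q 1

lemma coord_lin (hq0 : q ≠ 0) (r : K) : coord hq0 (lin q r) = ![0, 1, r, 0, 0, 0, 0, 0] := by
  rw [← coord_ofCoord hq0 ![0, 1, r, 0, 0, 0, 0, 0]]
  simp [ofCoord_apply, lin]

lemma lin_mul_lin (hq0 : q ≠ 0) (r : K) : lin q r * lin q (q * r) = 0 := by
  apply (coord hq0).injective
  rw [coord_mul, coord_lin, coord_lin, map_zero]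
  ext j
  fin_cases j <;> simp

lemma exists_eq_lin_mul (hq0 : q ≠ 0) {r : K} {a : LiuSchulzAlgebra K q} (h : lin q r * a = 0) :
    ∃ b, a = lin q (q * r) * b := by
  have h' := congrArg (coord hq0) h
  rw [coord_mul, coord_lin, map_zero] at h'
  generalize hv : coord hq0 a = v at h'
  have h₀ : v 0 = 0 := by simpa using congrFun h' 1
  have h₃ : v 3 = 0 := by simpa [hq0] using congrFun h' 6
  have h₂ : v 2 - q * r * v 1 = 0 := by simpa using congrFun h' 4
  have h₅ : v 5 + r * v 6 = 0 := by simpa using congrFun h' 7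
  -- The witness solves the linear system for `b` coordinate by coordinate.
  refine ⟨ofCoord q ![v 1, 0, v 4, -v 6 / q, 0, v 7, 0, 0], (coord hq0).injective ?_⟩
  rw [coord_mul, coord_lin, coord_ofCoord, hv]
  ext j
  fin_cases j <;> simp [h₀, h₃]
  · linear_combination h₂
  · field_simp
    linear_combination h₅
  · field_simp

lemma exists_eq_mul_lin (hq0 : q ≠ 0) {r : K} {a : LiuSchulzAlgebra K q}
    (h : a * lin q (q * r) = 0) : ∃ b, a = b * lin q r := by
  have h' := congrArg (coord hq0) h
  rw [coord_mul, coord_lin, map_zero] at h'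
  generalize hv : coord hq0 a = v at h'
  have h₀ : v 0 = 0 := by simpa using congrFun h' 1
  have h₃ : v 3 = 0 := by simpa using congrFun h' 6
  have h₂ : v 1 * (q * r) - q * v 2 = 0 := by simpa using congrFun h' 4
  have h₅ : v 5 + v 6 * (q * r) = 0 := by simpa using congrFun h' 7
  refine ⟨ofCoord q ![v 1, 0, -v 4 / q, v 6, 0, v 7, 0, 0], (coord hq0).injective ?_⟩
  rw [coord_mul, coord_lin, coord_ofCoord, hv]
  ext j
  fin_cases j <;> simp [h₀, h₃]
  · exact mul_left_cancel₀ hq0 (by linear_combination -h₂)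
  · field_simp
  · linear_combination h₅

/-- This is the vanishing of `Ext^k(I₀, I₀)`, with `r = q^{-(k+1)}`. Two of the inequalities confine
`b (x₀ + x₁)` to the span of `x₀x₁` and `x₀x₁x₂`; the other two make the coefficients reaching that
span invertible. At `k = 1` the condition `q²r ≠ 1` fails. -/
lemma exists_mul_lin_eq_lin_mul (hq0 : q ≠ 0) {r : K} (hr : r ≠ 1) (h₁ : q * r ≠ 1) (h₂ : r ≠ q)
    (h₃ : q * (q * r) ≠ 1) {b : LiuSchulzAlgebra K q} (h : lin q r * (b * lin q 1) = 0) :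
    ∃ c, b * lin q 1 = lin q (q * r) * (c * lin q 1) := by
  have h' := congrArg (coord hq0) h
  rw [coord_mul, coord_mul, coord_lin, coord_lin, map_zero] at h'
  generalize hv : coord hq0 b = v at h'
  have e₀ : v 0 = 0 := by
    have : v 0 - q * r * v 0 = 0 := by simpa using congrFun h' 4
    have : (1 - q * r) * v 0 = 0 := by linear_combination this
    exact (mul_eq_zero.1 this).resolve_left (sub_ne_zero.2 h₁.symm)
  have e₃ : v 3 = 0 := by
    have : -(q * v 3) + r * v 3 = 0 := by simpa using congrFun h' 7
    have : (r - q) * v 3 = 0 := by linear_combination this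
    exact (mul_eq_zero.1 this).resolve_left (sub_ne_zero.2 h₂)
  have n₁ : 1 - q * (q * r) ≠ 0 := sub_ne_zero.2 h₃.symm
  have n₂ : r - 1 ≠ 0 := sub_ne_zero.2 hr
  -- The constant term of `c` produces the `x₀x₁` coefficient, and its `x₂` term the `x₀x₁x₂`
  -- coefficient.
  refine ⟨ofCoord q ![(v 1 - q * v 2) / (1 - q * (q * r)), 0, 0, (v 5 + v 6) / (q * (r - 1)),
    0, 0, 0, 0], (coord hq0).injective ?_⟩
  rw [coord_mul, coord_mul, coord_mul, coord_lin, coord_lin, coord_ofCoord, hv]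
  ext j
  fin_cases j <;> simp [e₀, e₃]
  · linear_combination -div_mul_cancel₀ (v 1 - q * v 2) n₁
  · field_simp
    ring

/-- The sequence of elements `x₀ + q⁻ᵏ x₁`. -/
noncomputable def elt (q : K) (k : ℕ) : LiuSchulzAlgebra K q := lin q (q⁻¹ ^ k)

lemma mul_inv_pow (hq0 : q ≠ 0) (k : ℕ) : q * q⁻¹ ^ (k + 1) = q⁻¹ ^ k := by
  rw [pow_succ', mul_inv_cancel_left₀ hq0]

lemma inv_pow_ne_one (hq : ∀ n : ℕ, 0 < n → q ^ n ≠ 1) {k : ℕ} (hk : 0 < k) : q⁻¹ ^ k ≠ 1 := by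
  rw [inv_pow]
  exact fun h => hq k hk (inv_eq_one.1 h)

lemma elt_mul_elt (hq0 : q ≠ 0) (k : ℕ) : elt q (k + 1) * elt q k = 0 := by
  rw [elt, elt, ← mul_inv_pow hq0 k]
  exact lin_mul_lin hq0 _

lemma exactMul_elt (hq0 : q ≠ 0) (k : ℕ) :
    ExactMul (elt q (k + 1)) (elt q k) (LiuSchulzAlgebra K q) := by
  intro a ha
  obtain ⟨b, hb⟩ := exists_eq_lin_mul hq0 ha
  exact ⟨b, by rwa [mul_inv_pow hq0] at hb⟩

lemma exactMul_cyclicIdeal_elt (hq0 : q ≠ 0) (hq : ∀ n : ℕ, 0 < n → q ^ n ≠ 1) (k : ℕ) (hk : 2 ≤ k) :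
    ExactMul (elt q (k + 1)) (elt q k) (cyclicIdeal (elt q) 0) := by
  rintro ⟨a, ha⟩ h
  obtain ⟨b, rfl⟩ := Submodule.mem_span_singleton.1 ha
  have h₀ : elt q 0 = lin q 1 := by rw [elt, pow_zero]
  obtain ⟨l, rfl⟩ : ∃ l, k = l + 1 := ⟨k - 1, by omega⟩
  obtain ⟨c, hc⟩ := exists_mul_lin_eq_lin_mul hq0 (r := q⁻¹ ^ (l + 1 + 1)) (b := b)
    (inv_pow_ne_one hq (by omega))
    (by rw [mul_inv_pow hq0]; exact inv_pow_ne_one hq (by omega))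
    (fun h => inv_pow_ne_one hq (k := l + 1 + 1 + 1) (by omega) <| by
      rw [pow_succ, h, mul_inv_cancel₀ hq0])
    (by rw [mul_inv_pow hq0, mul_inv_pow hq0]; exact inv_pow_ne_one hq (by omega))
    (by rw [← h₀]; exact congrArg Subtype.val h)
  rw [mul_inv_pow hq0, ← h₀] at hc
  exact ⟨⟨c * elt q 0, Submodule.smul_mem _ c (Submodule.mem_span_singleton_self _)⟩,
    Subtype.ext hc⟩

lemma mul_elt_eq_zero_iff (hq0 : q ≠ 0) (k : ℕ) (a : LiuSchulzAlgebra K q) :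
    a * elt q k = 0 ↔ ∃ b, a = b * elt q (k + 1) := by
  constructor
  · intro h
    rw [elt, ← mul_inv_pow hq0] at h
    exact exists_eq_mul_lin hq0 h
  · rintro ⟨b, rfl⟩
    rw [mul_assoc, elt_mul_elt hq0, mul_zero]

/-- A splitting of `A → I₀` sends `v₀` to some `e` with `e v₀ = v₀` and `v₁ e = 0`; the first forces
constant term `1`, the second `0`. -/
lemma not_projective_cyclicIdeal (hq0 : q ≠ 0) :
    ¬ Module.Projective (LiuSchulzAlgebra K q) (cyclicIdeal (elt q) 0) := by
  intro
  obtain ⟨s, hs⟩ := Module.projective_lifting_property (cover (elt q) 0) LinearMap.id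
    (cover_surjective 0)
  let m : cyclicIdeal (elt q) 0 := ⟨elt q 0, Submodule.mem_span_singleton_self _⟩
  have h₁ : s m * elt q 0 = elt q 0 := congrArg Subtype.val (LinearMap.congr_fun hs m)
  have h₂ : elt q 1 * s m = 0 := by
    rw [← smul_eq_mul, ← map_smul, show elt q 1 • m = 0 from Subtype.ext (elt_mul_elt hq0 0),
      map_zero]
  have e₁ := congrFun (congrArg (coord hq0) h₁) 1
  have e₂ := congrFun (congrArg (coord hq0) h₂) 1
  simp only [coord_mul, elt, coord_lin] at e₁ e₂
  simp at e₁ e₂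
  simp [e₂] at e₁

end LiuSchulz

theorem proposition4p7 (K : Type u) [Field K] (q : K) (hq0 : q ≠ 0)
    (hq : ∀ n : ℕ, 0 < n → q ^ n ≠ 1) :
    IsLocalRing (LiuSchulzAlgebra K q) ∧
    IsSymmetricAlg K (LiuSchulzAlgebra K q) ∧
    QuasiProjective.qgldim (LiuSchulzAlgebra K q) = ⊤ ∧
    ∃ I₀ : ModuleCat.{u} (LiuSchulzAlgebra K q),
      Module.Finite (LiuSchulzAlgebra K q) I₀ ∧
      ¬ Module.Projective (LiuSchulzAlgebra K q) I₀ ∧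
      (∀ i : ℕ, 2 ≤ i → Subsingleton (Abelian.Ext I₀ I₀ i)) ∧
      QuasiProjective.qpd I₀ = ⊤ := by
  have hfin : Module.Finite (LiuSchulzAlgebra K q) (QuasiProjective.cyclicIdeal (LiuSchulz.elt q) 0) := inferInstance
  have hproj := LiuSchulz.not_projective_cyclicIdeal hq0
  have hqpd := QuasiProjective.qpd_eq_top
    (M := ModuleCat.of _ (QuasiProjective.cyclicIdeal (LiuSchulz.elt q) 0)) hproj (LiuSchulz.elt_mul_elt hq0)
    (fun k _ => LiuSchulz.exactMul_elt hq0 k) (LiuSchulz.exactMul_cyclicIdeal_elt hq0 hq)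
    (m := QuasiProjective.cover (LiuSchulz.elt q) 0 1)
    (fun x => (QuasiProjective.cover_surjective 0 x).imp fun a h => by rw [← h, ← map_smul]; simp)
    (fun r => by
      rw [← map_smul, ← LiuSchulz.mul_elt_eq_zero_iff hq0, ← QuasiProjective.coe_cover, smul_eq_mul,
        mul_one]
      exact Submodule.coe_eq_zero.symm)
  refine ⟨LiuSchulz.isLocalRing hq0, LiuSchulz.isSymmetricAlg hq0, ?_,
    ModuleCat.of _ (QuasiProjective.cyclicIdeal (LiuSchulz.elt q) 0), hfin, hproj, ?_, hqpd⟩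
  · have := LiuSchulz.finite hq0
    -- Noetherianity makes the finitely generated `I₀` finitely presented, so it counts in the
    -- supremum.
    have : IsNoetherianRing (LiuSchulzAlgebra K q) := IsNoetherianRing.of_finite K _
    rw [← top_le_iff, ← hqpd]
    exact le_iSup₂_of_le _ (Module.finitePresentation_of_finite _ _) le_rfl
  · intro i hi
    obtain ⟨n, rfl⟩ : ∃ n, i = n + 1 := ⟨i - 1, by omega⟩
    exact QuasiProjective.subsingleton_ext_cyclicIdeal (LiuSchulz.elt_mul_elt hq0)
      (LiuSchulz.mul_elt_eq_zero_iff hq0) (LiuSchulz.exactMul_cyclicIdeal_elt hq0 hq) n 0 (by omega)
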